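/- Let $1\le p<\infty$, let $A$ be a positive integer, let $b,\lambda\in\mathbb{C}$ with $\lambda\neq 0$, let $\alpha$ be a real number with $\alpha>|b/\lambda|$, and put $g(z)=bz^A$ for $z\in\mathbb{C}$. Let $dA(z)$ denote Lebesgue area measure on $\mathbb{C}$, and let $\mathcal{F}^p_{\alpha,A}$ be the space of entire functions $h$ with $\int_{\mathbb{C}}\bigl|h(z)e^{-\alpha|z|^A}\bigr|^p\,dA(z)<\infty$. Then there is a constant $C>0$, depending only on $p,\alpha,A,b,\lambda$, such that for every entire function $f$ with $fe^{g/\lambda}\in\mathcal{F}^p_{\alpha,A}$, $$\int_{\mathbb{C}}|f(z)|^p\,\bigl|e^{g(z)/\lambda}\bigr|^p e^{-p\alpha|z|^A}\,dA(z)\le C\left(|f(0)|^p+\int_{\mathbb{C}}|f'(z)|^p\,\bigl|e^{g(z)/\lambda}\bigr|^p\,\frac{e^{-p\alpha|z|^A}}{(1+|z|)^{(A-1)p}}\,dA(z)\right).$$ -/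

import Mathlib

open MeasureTheory

/-- The generalized Fock space of exponent `p` and parameters `α`, `A`: the entire functions `f`
such that `z ↦ |f z * exp (-α * |z| ^ A)| ^ p` has a finite integral with respect to the Lebesgue
area measure on `ℂ`. -/
def fockSpace (p α A : ℝ) : Set (ℂ → ℂ) :=
  {f | Differentiable ℂ f ∧
    ∫⁻ z : ℂ, ENNReal.ofReal ((‖f z‖ * Real.exp (-α * ‖z‖ ^ A)) ^ p) < ⊤}

section FockWeights

open Set Filter Topology ENNReal

/-! In polar coordinates the homogeneity of `g` turns the weight on each ray into `exp (-p φ r ^ A)`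
(`weight_polar`), where `φ ≥ α - ‖b / l‖ > 0` for every angle. The claim thus becomes a
one-dimensional Hardy inequality, with constant uniform in the angle.

The Hardy inequality (`lintegral_hardy_exp_le`) is Hölder against an explicit exponential density,
then Tonelli, then a tail estimate; each integration of the exponential gains a power `s ^ (-(A -
1))`, which produces the denominator.

It is used only for radii above 1. Inside the unit disc the mean value property bounds `f'` by its
integral over the disc of radius 2 (`enorm_le_lintegral_ball`), where the weight is bounded below.
The constant terms are harmless because the full weight is integrable. -/

/-! ### Hardy inequality on a half-line. -/

lemma rpow_lintegral_le_weighted {X : Type*} [MeasurableSpace X] {μ : Measure X} {p : ℝ}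
    (hp : 1 ≤ p) {v k : X → ℝ≥0∞} (hv : AEMeasurable v μ) (hk : AEMeasurable k μ)
    (h0 : ∀ᵐ x ∂μ, k x ≠ 0) (ht : ∀ᵐ x ∂μ, k x ≠ ⊤) :
    (∫⁻ x, v x ∂μ) ^ p ≤ (∫⁻ x, v x ^ p * k x ^ (1 - p) ∂μ) * (∫⁻ x, k x ∂μ) ^ (p - 1) := by
  have hp0 : 0 < p := by linarith
  have hq : 0 ≤ 1 - 1 / p := by
    rw [sub_nonneg, div_le_one hp0]; exact hp
  -- Hölder for `v = (v ^ p * k ^ (1 - p)) ^ (1 / p) * k ^ (1 - 1 / p)`.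
  have h := ENNReal.lintegral_mul_norm_pow_le (μ := μ) (f := fun x => v x ^ p * k x ^ (1 - p))
    (g := k) (by fun_prop) hk (p := 1 / p) (q := 1 - 1 / p) (by positivity) hq (by ring)
  have e : ∫⁻ x, (v x ^ p * k x ^ (1 - p)) ^ (1 / p) * k x ^ (1 - 1 / p) ∂μ = ∫⁻ x, v x ∂μ := by
    apply lintegral_congr_ae
    filter_upwards [h0, ht] with x hx0 hxt
    rw [ENNReal.mul_rpow_of_nonneg _ _ (by positivity), ← ENNReal.rpow_mul, ← ENNReal.rpow_mul,
      mul_assoc, ← ENNReal.rpow_add _ _ hx0 hxt]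
    have e1 : p * (1 / p) = 1 := by field_simp
    have e2 : (1 - p) * (1 / p) + (1 - 1 / p) = 0 := by field_simp; ring
    rw [e1, e2]; simp
  rw [e] at h
  have h' := ENNReal.rpow_le_rpow h hp0.le
  rw [ENNReal.mul_rpow_of_nonneg _ _ hp0.le, ← ENNReal.rpow_mul, ← ENNReal.rpow_mul] at h'
  have e1 : 1 / p * p = 1 := by field_simp
  have e2 : (1 - 1 / p) * p = p - 1 := by field_simp
  rwa [e1, e2, ENNReal.rpow_one] at h'

lemma lintegral_Ioc_mul_eq_lintegral_mul_Ici {F G : ℝ → ℝ≥0∞} (hF : Measurable F)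
    (hG : Measurable G) (a : ℝ) :
    ∫⁻ r in Ioi a, (∫⁻ s in Ioc a r, F s) * G r = ∫⁻ s in Ioi a, F s * ∫⁻ r in Ici s, G r := by
  let T : Set (ℝ × ℝ) := {x | x.2 ≤ x.1}
  have hT : MeasurableSet T := measurableSet_le measurable_snd measurable_fst
  let H : ℝ → ℝ → ℝ≥0∞ := fun r s => T.indicator (fun x => F x.2 * G x.1) (r, s)
  have hH : Measurable (Function.uncurry H) :=
    ((hF.comp measurable_snd).mul (hG.comp measurable_fst)).indicator hT
  have h1 : ∀ r, (∫⁻ s in Ioc a r, F s) * G r = ∫⁻ s in Ioi a, H r s := by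
    intro r
    rw [← lintegral_mul_const _ hF, ← Ioi_inter_Iic, inter_comm,
      ← Measure.restrict_restrict measurableSet_Iic, ← lintegral_indicator measurableSet_Iic]
    rfl
  have h2 : ∀ s ∈ Ioi a, F s * ∫⁻ r in Ici s, G r = ∫⁻ r in Ioi a, H r s := by
    intro s hs
    have e : Ici s = Ici s ∩ Ioi a := by
      ext x; simp only [mem_Ici, mem_inter_iff, mem_Ioi] at *
      exact ⟨fun h => ⟨h, hs.trans_le h⟩, fun h => h.1⟩
    rw [← lintegral_const_mul _ hG, e,
      ← Measure.restrict_restrict measurableSet_Ici, ← lintegral_indicator measurableSet_Ici]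
    rfl
  simp_rw [h1]
  rw [setLIntegral_congr_fun measurableSet_Ioi h2]
  exact lintegral_lintegral_swap hH.aemeasurable

lemma lintegral_Ici_mul_exp_neg_mul_pow_le {A : ℕ} (hA : 0 < A) {c q s : ℝ} (hc : 0 < c)
    (hcq : c ≤ q) (hs : 1 ≤ s) :
    ∫⁻ r in Ici s, ENNReal.ofReal (r * Real.exp (-q * r ^ A)) ≤
      ENNReal.ofReal ((1 / c + 1 / c ^ 2) * (s * Real.exp (-q * s ^ A) / s ^ (A - 1))) := by
  have hq : 0 < q := hc.trans_le hcq
  have hA' : (1 : ℝ) ≤ A := by exact_mod_cast hA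
  have hs0 : 0 < s := by linarith
  -- The shift `m` makes `m * q * A * r ^ (A - 1) ≥ 1`, absorbing the `-1` that comes from
  -- differentiating the factor `r + m` in `g`.
  set m : ℝ := 1 / (q * A) with hm
  have hm0 : 0 < m := by positivity
  set g : ℝ → ℝ := fun r => -((r + m) * Real.exp (-q * r ^ A)) with hg
  set g' : ℝ → ℝ := fun r => Real.exp (-q * r ^ A) * ((r + m) * (q * A * r ^ (A - 1)) - 1) with hg'
  have hd : ∀ r, HasDerivAt g (g' r) r := by
    intro r
    have h := (((hasDerivAt_id r).add_const m).mul
      (((hasDerivAt_pow A r).const_mul (-q)).exp)).neg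
    refine h.congr_deriv ?_
    simp only [hg', id]
    ring
  have hlow : ∀ r, s ≤ r → q * A * s ^ (A - 1) * (r * Real.exp (-q * r ^ A)) ≤ g' r := by
    intro r hr
    have h1 : (1 : ℝ) ≤ r ^ (A - 1) := one_le_pow₀ (hs.trans hr)
    have h2 : s ^ (A - 1) ≤ r ^ (A - 1) := pow_le_pow_left₀ hs0.le hr _
    have h3 : m * (q * A) = 1 := by rw [hm]; field_simp
    have h4 : q * A * s ^ (A - 1) * r ≤ (r + m) * (q * A * r ^ (A - 1)) - 1 := by
      have e : (r + m) * (q * A * r ^ (A - 1)) = q * A * r ^ (A - 1) * r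
        + (m * (q * A)) * r ^ (A - 1) := by ring
      rw [e, h3]
      have : q * A * s ^ (A - 1) * r ≤ q * A * r ^ (A - 1) * r := by
        have : 0 ≤ r := by linarith
        gcongr
      linarith
    calc _ = Real.exp (-q * r ^ A) * (q * A * s ^ (A - 1) * r) := by ring
      _ ≤ _ := by simp only [hg']; gcongr
  have hpos : ∀ r ∈ Ioi s, 0 ≤ g' r := by
    intro r hr
    have hr : s < r := hr
    refine le_trans ?_ (hlow r hr.le)
    have : 0 < r := by linarith
    positivity
  have hlim : Tendsto g atTop (𝓝 0) := by
    have h1 : Tendsto (fun r : ℝ => (r + m) * Real.exp (-q * r)) atTop (𝓝 0) := by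
      have h2 := tendsto_rpow_mul_exp_neg_mul_atTop_nhds_zero 1 q hq
      have h3 := (tendsto_rpow_mul_exp_neg_mul_atTop_nhds_zero 0 q hq).const_mul m
      have := h2.add h3
      simp only [mul_zero, add_zero] at this
      refine this.congr fun r => ?_
      simp only [Real.rpow_one, Real.rpow_zero]; ring
    have h2 : Tendsto (fun r : ℝ => (r + m) * Real.exp (-q * r ^ A)) atTop (𝓝 0) := by
      refine squeeze_zero' ?_ ?_ h1
      · filter_upwards [eventually_ge_atTop 1] with r hr
        positivity
      · filter_upwards [eventually_ge_atTop 1] with r hr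
        have : r ≤ r ^ A := le_self_pow₀ hr hA.ne'
        have : -q * r ^ A ≤ -q * r := by nlinarith
        gcongr
    simpa only [neg_zero] using h2.neg
  have hint := integrableOn_Ioi_deriv_of_nonneg' (fun x _ => hd x) hpos hlim
  have hval := integral_Ioi_of_hasDerivAt_of_nonneg' (fun x _ => hd x) hpos hlim
  have hqs : 0 < q * A * s ^ (A - 1) := by positivity
  rw [setLIntegral_congr Ioi_ae_eq_Ici.symm]
  calc ∫⁻ r in Ioi s, ENNReal.ofReal (r * Real.exp (-q * r ^ A))
      ≤ ∫⁻ r in Ioi s, ENNReal.ofReal ((q * A * s ^ (A - 1))⁻¹ * g' r) := by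
        refine setLIntegral_mono' measurableSet_Ioi fun r hr => ENNReal.ofReal_le_ofReal ?_
        rw [le_inv_mul_iff₀ hqs]
        exact hlow r (le_of_lt hr)
    _ = ENNReal.ofReal (∫ r in Ioi s, (q * A * s ^ (A - 1))⁻¹ * g' r) := by
        rw [ofReal_integral_eq_lintegral_ofReal (hint.const_mul _)]
        filter_upwards [ae_restrict_mem measurableSet_Ioi] with r hr
        have := hpos r hr
        positivity
    _ ≤ _ := by
        apply ENNReal.ofReal_le_ofReal
        rw [integral_const_mul, hval]
        simp only [hg, zero_sub, neg_neg]
        have hcA : c ≤ q * A := by nlinarith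
        have hm1 : m ≤ 1 / c * s := by
          rw [hm]
          calc 1 / (q * A) ≤ 1 / c := by gcongr
            _ ≤ 1 / c * s := le_mul_of_one_le_right (by positivity) hs
        have h5 : (q * A)⁻¹ ≤ 1 / c := by rw [← one_div]; gcongr
        calc (q * A * s ^ (A - 1))⁻¹ * ((s + m) * Real.exp (-q * s ^ A))
            = (q * A)⁻¹ * (s + m) * (Real.exp (-q * s ^ A) / s ^ (A - 1)) := by
              rw [mul_inv]; ring
          _ ≤ 1 / c * (s + 1 / c * s) * (Real.exp (-q * s ^ A) / s ^ (A - 1)) := by gcongr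
          _ = _ := by ring

lemma lintegral_Ioc_deriv_exp_mul_pow_le (A : ℕ) {c r : ℝ} (hc : 0 < c) (hr : 1 ≤ r) :
    ∫⁻ s in Ioc 1 r, ENNReal.ofReal (Real.exp (c * s ^ A) * (A * s ^ (A - 1))) ≤
      ENNReal.ofReal (Real.exp (c * r ^ A) / c) := by
  have hd : ∀ s : ℝ, HasDerivAt (fun s => Real.exp (c * s ^ A) / c)
      (Real.exp (c * s ^ A) * (A * s ^ (A - 1))) s := by
    intro s
    refine ((((hasDerivAt_pow A s).const_mul c).exp).div_const c).congr_deriv ?_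
    field_simp
  have hcont : Continuous fun s : ℝ => Real.exp (c * s ^ A) * (A * s ^ (A - 1)) := by fun_prop
  have hval := intervalIntegral.integral_eq_sub_of_hasDerivAt (a := 1) (b := r) (fun x _ => hd x)
    (hcont.intervalIntegrable _ _)
  rw [intervalIntegral.integral_of_le hr] at hval
  rw [← ofReal_integral_eq_lintegral_ofReal
    ((hcont.intervalIntegrable 1 r).1), hval]
  · apply ENNReal.ofReal_le_ofReal
    have : 0 ≤ Real.exp (c * 1 ^ A) / c := by positivity
    linarith
  · filter_upwards [ae_restrict_mem measurableSet_Ioc] with s hs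
    have : 0 < s := by linarith [hs.1]
    positivity

/-- A weighted Hardy inequality on `(1, ∞)` for weights of exponential type. -/
lemma lintegral_hardy_exp_le {p : ℝ} (hp : 1 ≤ p) {A : ℕ} (hA : 0 < A) {c φ : ℝ} (hc : 0 < c)
    (hφ : c ≤ φ) {v : ℝ → ℝ≥0∞} (hv : Measurable v) :
    ∫⁻ r in Ioi 1, (∫⁻ s in Ioc 1 r, v s) ^ p * ENNReal.ofReal (r * Real.exp (-p * φ * r ^ A)) ≤
      ENNReal.ofReal (c ^ (1 - p) * (1 / c + 1 / c ^ 2) * 2 ^ (((A : ℝ) - 1) * p)) *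
        ∫⁻ s in Ioi 1, v s ^ p * ENNReal.ofReal
          (s * (Real.exp (-p * φ * s ^ A) / (1 + s) ^ (((A : ℝ) - 1) * p))) := by
  have hA' : (1 : ℝ) ≤ A := by exact_mod_cast hA
  -- The Hölder density is the derivative of `exp (c * s ^ A) / c`, so its integral is explicit.
  set κ : ℝ → ℝ := fun s => Real.exp (c * s ^ A) * (A * s ^ (A - 1)) with hκ
  have hκc : Continuous κ := by fun_prop
  have hκ0 : ∀ s, 1 < s → 0 < κ s := fun s hs => by
    have : 0 < s := by linarith
    positivity
  -- The decay rate left after Hölder contributes `exp ((p - 1) * c * r ^ A)`; `φ ≥ c` gives `q ≥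
  -- c`, so the tail constant depends only on `c`.
  set q : ℝ := p * φ - (p - 1) * c with hq
  have hcq : c ≤ q := by nlinarith
  set F : ℝ → ℝ≥0∞ := fun s => v s ^ p * ENNReal.ofReal (κ s) ^ (1 - p) with hF
  have hFm : Measurable F := by fun_prop
  set G : ℝ → ℝ≥0∞ := fun r => ENNReal.ofReal (c ^ (1 - p)) *
    ENNReal.ofReal (r * Real.exp (-q * r ^ A)) with hG
  have hGm : Measurable G := by fun_prop
  have step : ∀ r ∈ Ioi (1 : ℝ), (∫⁻ s in Ioc 1 r, v s) ^ p *
      ENNReal.ofReal (r * Real.exp (-p * φ * r ^ A)) ≤ (∫⁻ s in Ioc 1 r, F s) * G r := by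
    intro r hr
    have hr : 1 < r := hr
    have hr0 : 0 < r := by linarith
    have h := rpow_lintegral_le_weighted (μ := volume.restrict (Ioc 1 r)) hp hv.aemeasurable
      (k := fun s => ENNReal.ofReal (κ s)) (by fun_prop)
      (by filter_upwards [ae_restrict_mem measurableSet_Ioc] with s hs
          simpa using hκ0 s hs.1) (by simp)
    have h2 := ENNReal.rpow_le_rpow (lintegral_Ioc_deriv_exp_mul_pow_le A hc hr.le)
      (sub_nonneg.2 hp)
    calc _ ≤ ((∫⁻ s in Ioc 1 r, F s) * ENNReal.ofReal (Real.exp (c * r ^ A) / c) ^ (p - 1)) *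
          ENNReal.ofReal (r * Real.exp (-p * φ * r ^ A)) := by
          gcongr
          exact h.trans (by gcongr)
      _ = _ := by
          simp only [hG]
          rw [mul_assoc, ENNReal.ofReal_rpow_of_pos (by positivity),
            ← ENNReal.ofReal_mul (by positivity), ← ENNReal.ofReal_mul (by positivity)]
          congr 2
          rw [Real.div_rpow (by positivity) hc.le, ← Real.exp_mul,
            show (1 - p) = -(p - 1) by ring, Real.rpow_neg hc.le]
          have : Real.exp (-q * r ^ A) =
              Real.exp (c * r ^ A * (p - 1)) * Real.exp (-p * φ * r ^ A) := by
            rw [← Real.exp_add]; congr 1; rw [hq]; ring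
          rw [this]; ring
  calc _ ≤ ∫⁻ r in Ioi 1, (∫⁻ s in Ioc 1 r, F s) * G r :=
        setLIntegral_mono' measurableSet_Ioi step
    _ = ∫⁻ s in Ioi 1, F s * ∫⁻ r in Ici s, G r :=
        lintegral_Ioc_mul_eq_lintegral_mul_Ici hFm hGm 1
    _ ≤ ∫⁻ s in Ioi 1, ENNReal.ofReal
          (c ^ (1 - p) * (1 / c + 1 / c ^ 2) * 2 ^ (((A : ℝ) - 1) * p)) * (v s ^ p *
          ENNReal.ofReal (s * (Real.exp (-p * φ * s ^ A) / (1 + s) ^ (((A : ℝ) - 1) * p)))) := by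
        refine setLIntegral_mono' measurableSet_Ioi fun s hs => ?_
        have hs : 1 < s := hs
        have hs0 : 0 < s := by linarith
        rw [hG, lintegral_const_mul _ (by fun_prop)]
        refine (mul_le_mul_right (mul_le_mul_right
          (lintegral_Ici_mul_exp_neg_mul_pow_le hA hc hcq hs.le) _) _).trans ?_
        simp only [hF]
        rw [mul_left_comm (ENNReal.ofReal _) (v s ^ p), mul_assoc (v s ^ p)]
        refine mul_le_mul_right ?_ _
        rw [ENNReal.ofReal_rpow_of_pos (hκ0 s hs), ← ENNReal.ofReal_mul (by positivity),
          ← ENNReal.ofReal_mul (Real.rpow_nonneg (hκ0 s hs).le _),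
          ← ENNReal.ofReal_mul (by positivity)]
        apply ENNReal.ofReal_le_ofReal
        have e1 : (A : ℝ) ^ (1 - p) ≤ 1 := Real.rpow_le_one_of_one_le_of_nonpos hA' (by linarith)
        have e2 : κ s ^ (1 - p) = Real.exp (c * s ^ A * (1 - p)) *
            ((A : ℝ) ^ (1 - p) * (s ^ (A - 1)) ^ (1 - p)) := by
          rw [hκ, Real.mul_rpow (by positivity) (by positivity), ← Real.exp_mul,
            Real.mul_rpow (by positivity) (by positivity)]
        have e3 : (s ^ (A - 1)) ^ (1 - p) / s ^ (A - 1) = (s ^ (((A : ℝ) - 1) * p))⁻¹ := by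
          rw [← Real.rpow_natCast, Nat.cast_sub hA, Nat.cast_one, ← Real.rpow_mul hs0.le,
            ← Real.rpow_sub hs0, ← Real.rpow_neg hs0.le]
          congr 1; ring
        -- The power of 2 comes from `1 + s ≤ 2 * s`.
        have e4 : (s ^ (((A : ℝ) - 1) * p))⁻¹ ≤
            2 ^ (((A : ℝ) - 1) * p) / (1 + s) ^ (((A : ℝ) - 1) * p) := by
          have hE : 0 ≤ ((A : ℝ) - 1) * p := by nlinarith
          rw [inv_eq_one_div, div_le_div_iff₀ (by positivity) (by positivity), one_mul,
            ← Real.mul_rpow (by norm_num) hs0.le]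
          exact Real.rpow_le_rpow (by positivity) (by linarith) hE
        have e5 : Real.exp (c * s ^ A * (1 - p)) * Real.exp (-q * s ^ A) =
            Real.exp (-p * φ * s ^ A) := by
          rw [← Real.exp_add]; congr 1; rw [hq]; ring
        rw [e2]
        calc _ = c ^ (1 - p) * (1 / c + 1 / c ^ 2) * s *
              (Real.exp (c * s ^ A * (1 - p)) * Real.exp (-q * s ^ A)) *
              ((A : ℝ) ^ (1 - p) * ((s ^ (A - 1)) ^ (1 - p) / s ^ (A - 1))) := by ring
          _ ≤ c ^ (1 - p) * (1 / c + 1 / c ^ 2) * s * Real.exp (-p * φ * s ^ A) *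
              (1 * (2 ^ (((A : ℝ) - 1) * p) / (1 + s) ^ (((A : ℝ) - 1) * p))) := by
              rw [e3, e5]; gcongr
          _ = _ := by ring
    _ = _ := lintegral_const_mul' _ _ ENNReal.ofReal_ne_top

/-! ### Polar coordinates and local estimates. -/

lemma lintegral_complex_eq_lintegral_polar {F : ℂ → ℝ≥0∞} (hF : Measurable F) :
    ∫⁻ z, F z = ∫⁻ θ in Ioo (-Real.pi) Real.pi, ∫⁻ r in Ioi (0 : ℝ),
      ENNReal.ofReal r * F (r * Complex.exp (θ * Complex.I)) := by
  rw [← Complex.lintegral_comp_polarCoord_symm, polarCoord_target,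
    Measure.volume_eq_prod, ← Measure.prod_restrict, lintegral_prod_symm]
  · simp [Complex.exp_mul_I]
  · simp only [Complex.polarCoord_symm_apply, smul_eq_mul]
    fun_prop

/-- Integrate the circle mean value property against `r dr`; no normalisation is needed since the
unit disc has area `π ≥ 1`. -/
lemma enorm_le_lintegral_ball {h : ℂ → ℂ} (hh : Differentiable ℂ h) (c : ℂ) :
    ‖h c‖ₑ ≤ ∫⁻ z in Metric.ball c 1, ‖h z‖ₑ := by
  have hmeas : Measurable h := hh.continuous.measurable
  have hcirc : ∀ r : ℝ, ENNReal.ofReal (2 * Real.pi) * ‖h c‖ₑ ≤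
      ∫⁻ θ in Ioo (-Real.pi) Real.pi, ‖h (c + r * Complex.exp (θ * Complex.I))‖ₑ := by
    intro r
    have hm : Real.circleAverage h c r = h c := hh.diffContOnCl.circleAverage
    have hper : Function.Periodic (fun θ => h (circleMap c r θ)) (2 * Real.pi) := fun θ => by
      simp only [periodic_circleMap c r θ]
    have he := hper.intervalIntegral_add_eq 0 (-Real.pi)
    rw [Real.circleAverage_def, ← zero_add (2 * Real.pi), he,
      show -Real.pi + 2 * Real.pi = Real.pi by ring, zero_add,
      inv_smul_eq_iff₀ (by positivity),
      intervalIntegral.integral_of_le (by linarith [Real.pi_pos])] at hm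
    calc ENNReal.ofReal (2 * Real.pi) * ‖h c‖ₑ = ‖(2 * Real.pi) • h c‖ₑ := by
          rw [enorm_smul, Real.enorm_of_nonneg (by positivity)]
      _ ≤ ∫⁻ θ in Ioc (-Real.pi) Real.pi, ‖h (circleMap c r θ)‖ₑ := by
          rw [← hm]; exact enorm_integral_le_lintegral_enorm _
      _ = _ := by rw [setLIntegral_congr Ioo_ae_eq_Ioc.symm]; rfl
  have hball : ∫⁻ z in Metric.ball c 1, ‖h z‖ₑ =
      ∫⁻ z, (Metric.ball (0 : ℂ) 1).indicator (fun z => ‖h (c + z)‖ₑ) z := by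
    rw [← lintegral_indicator Metric.isOpen_ball.measurableSet,
      ← lintegral_add_left_eq_self _ c]
    congr 1; ext z
    simp [indicator]
  have hind : Measurable ((Metric.ball (0 : ℂ) 1).indicator fun z => ‖h (c + z)‖ₑ) :=
    Measurable.indicator (by fun_prop) Metric.isOpen_ball.measurableSet
  rw [hball, lintegral_complex_eq_lintegral_polar hind, lintegral_lintegral_swap (by fun_prop)]
  calc ‖h c‖ₑ = 1 * ‖h c‖ₑ := (one_mul _).symm
    _ ≤ (∫⁻ r in Ioo (0 : ℝ) 1, ENNReal.ofReal r * ENNReal.ofReal (2 * Real.pi)) * ‖h c‖ₑ := by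
        gcongr
        rw [lintegral_mul_const _ (by fun_prop), setLIntegral_congr Ioo_ae_eq_Ioc,
          ← ofReal_integral_eq_lintegral_ofReal (f := fun r => r) (continuous_id.intervalIntegrable 0 1).1
            (by filter_upwards [ae_restrict_mem measurableSet_Ioc] with r hr using hr.1.le),
          ← intervalIntegral.integral_of_le zero_le_one]
        rw [integral_id]
        rw [← ENNReal.ofReal_mul (by norm_num), ENNReal.one_le_ofReal]
        nlinarith [Real.pi_gt_three]
    _ = ∫⁻ r in Ioo (0 : ℝ) 1, ENNReal.ofReal r * (ENNReal.ofReal (2 * Real.pi) * ‖h c‖ₑ) := by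
        rw [← lintegral_mul_const _ (by fun_prop)]
        simp only [mul_assoc]
    _ ≤ ∫⁻ r in Ioo (0 : ℝ) 1, ∫⁻ θ in Ioo (-Real.pi) Real.pi, ENNReal.ofReal r *
          (Metric.ball (0 : ℂ) 1).indicator (fun z => ‖h (c + z)‖ₑ)
            (r * Complex.exp (θ * Complex.I)) := by
        refine setLIntegral_mono' measurableSet_Ioo fun r hr => ?_
        have hmem : ∀ θ : ℝ, (r : ℂ) * Complex.exp (θ * Complex.I) ∈ Metric.ball (0 : ℂ) 1 := by
          intro θ
          simpa [Complex.norm_exp_ofReal_mul_I, abs_of_pos hr.1] using hr.2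
        simp only [indicator_of_mem (hmem _)]
        rw [lintegral_const_mul _ (by fun_prop)]
        gcongr
        exact hcirc r
    _ ≤ _ := lintegral_mono_set Ioo_subset_Ioi_self

lemma enorm_le_add_lintegral_deriv {f : ℂ → ℂ} (hf : Differentiable ℂ f) (e : ℂ) (he : ‖e‖ = 1)
    {r : ℝ} (hr : 0 ≤ r) :
    ‖f (r * e)‖ₑ ≤ ‖f 0‖ₑ + ∫⁻ s in Ioc 0 r, ‖deriv f (s * e)‖ₑ := by
  have hdc : Continuous (deriv f) := (hf.contDiff (n := 1)).continuous_deriv le_rfl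
  have hd : ∀ s : ℝ, HasDerivAt (fun s : ℝ => f (s * e)) (deriv f (s * e) * e) s := by
    intro s
    have h1 : HasDerivAt (fun s : ℝ => (s : ℂ) * e) e s := by
      simpa using (Complex.ofRealCLM.hasDerivAt (x := s)).mul_const e
    exact (hf _).hasDerivAt.comp s h1
  have hc : Continuous fun s : ℝ => deriv f (s * e) * e := by fun_prop
  have hval := intervalIntegral.integral_eq_sub_of_hasDerivAt (a := 0) (b := r) (fun x _ => hd x)
    (hc.intervalIntegrable _ _)
  rw [intervalIntegral.integral_of_le hr] at hval
  have he' : ‖e‖ₑ = 1 := by rw [← ofReal_norm, he]; simp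
  calc ‖f (r * e)‖ₑ = ‖f 0 + ∫ s in Ioc 0 r, deriv f (s * e) * e‖ₑ := by rw [hval]; simp
    _ ≤ ‖f 0‖ₑ + ‖∫ s in Ioc 0 r, deriv f (s * e) * e‖ₑ := enorm_add_le _ _
    _ ≤ _ := by
        gcongr
        refine (enorm_integral_le_lintegral_enorm _).trans_eq ?_
        simp [enorm_mul, he']

lemma lintegral_exp_neg_mul_norm_pow_lt_top {A : ℕ} (hA : 0 < A) {c : ℝ} (hc : 0 < c) :
    ∫⁻ z : ℂ, ENNReal.ofReal (Real.exp (-c * ‖z‖ ^ A)) < ⊤ := by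
  have h := Complex.integral_exp_neg_mul_rpow (p := A) (by exact_mod_cast hA) hc
  have hi : Integrable fun z : ℂ => Real.exp (-c * ‖z‖ ^ (A : ℝ)) := by
    -- A non-integrable function has integral 0 by convention, while the Gamma formula is positive.
    by_contra hn
    rw [integral_undef hn] at h
    have := Real.Gamma_pos_of_pos (s := 2 / (A : ℝ) + 1) (by positivity)
    have : 0 < Real.pi * c ^ (-2 / (A : ℝ)) * Real.Gamma (2 / A + 1) := by positivity
    linarith
  simp only [Real.rpow_natCast] at hi
  exact hi.lintegral_lt_top

/-- The local part: near the origin the derivative of an entire function is controlled by its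
weighted `L^p` norm. -/
lemma exists_rpow_lintegral_ball_le {p : ℝ} (hp : 1 ≤ p) {V : ℂ → ℝ} (hV : Continuous V)
    (hV0 : ∀ z, 0 < V z) (R : ℝ) :
    ∃ K : ℝ≥0∞, K ≠ ⊤ ∧ ∀ h : ℂ → ℂ, Measurable h →
      (∫⁻ z in Metric.ball (0 : ℂ) R, ‖h z‖ₑ) ^ p ≤
        K * ∫⁻ z, ‖h z‖ₑ ^ p * ENNReal.ofReal (V z) := by
  rcases lt_or_ge R 0 with hR | hR
  · refine ⟨0, by simp, fun h _ => ?_⟩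
    rw [Metric.ball_eq_empty.2 hR.le]
    simp [show 0 < p by linarith]
  obtain ⟨z₀, -, hmin⟩ := (isCompact_closedBall (0 : ℂ) R).exists_isMinOn
    ⟨0, by simpa using hR⟩ hV.continuousOn
  have hm := hV0 z₀
  have hball : volume (Metric.ball (0 : ℂ) R) ^ (p - 1) ≠ ⊤ :=
    ENNReal.rpow_ne_top_of_nonneg (by linarith) measure_ball_lt_top.ne
  refine ⟨ENNReal.ofReal (V z₀)⁻¹ * volume (Metric.ball (0 : ℂ) R) ^ (p - 1),
    ENNReal.mul_ne_top ENNReal.ofReal_ne_top hball, fun h hh => ?_⟩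
  have h1 := rpow_lintegral_le_weighted (μ := volume.restrict (Metric.ball (0 : ℂ) R)) hp
    (v := fun z => ‖h z‖ₑ) (k := fun _ => 1) (by fun_prop) (by fun_prop) (by simp) (by simp)
  simp only [ENNReal.one_rpow, mul_one, lintegral_const, Measure.restrict_apply_univ,
    one_mul] at h1
  refine h1.trans ?_
  rw [mul_comm, mul_comm (ENNReal.ofReal _), mul_assoc]
  gcongr
  rw [← lintegral_const_mul' _ _ ENNReal.ofReal_ne_top]
  refine le_trans ?_ (setLIntegral_le_lintegral (Metric.ball (0 : ℂ) R) _)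
  refine setLIntegral_mono' Metric.isOpen_ball.measurableSet fun z hz => ?_
  have hz' : V z₀ ≤ V z := hmin (Metric.ball_subset_closedBall hz)
  rw [mul_left_comm, ← ENNReal.ofReal_mul (by positivity)]
  refine le_mul_of_one_le_right (zero_le) ?_
  rw [ENNReal.one_le_ofReal, ← div_eq_inv_mul, one_le_div hm]
  exact hz'

/-! ### The weight along rays and the global estimate. -/

lemma weight_polar (p : ℝ) (A : ℕ) (b l : ℂ) (α : ℝ) {r : ℝ} (hr : 0 ≤ r) (θ : ℝ) :
    ‖Complex.exp (b * (r * Complex.exp (θ * Complex.I)) ^ A / l)‖ ^ p *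
        Real.exp (-p * α * ‖(r : ℂ) * Complex.exp (θ * Complex.I)‖ ^ A) =
      Real.exp (-p * (α - (b / l * Complex.exp (θ * Complex.I) ^ A).re) * r ^ A) := by
  have h1 : b * (r * Complex.exp (θ * Complex.I)) ^ A / l =
      ((r ^ A : ℝ) : ℂ) * (b / l * Complex.exp (θ * Complex.I) ^ A) := by
    push_cast; ring
  have h2 : ‖(r : ℂ) * Complex.exp (θ * Complex.I)‖ = r := by
    rw [norm_mul, Complex.norm_exp_ofReal_mul_I, mul_one, Complex.norm_real, Real.norm_of_nonneg hr]
  rw [h1, h2, Complex.norm_exp, Complex.re_ofReal_mul, ← Real.exp_mul, ← Real.exp_add]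
  congr 1; ring

lemma lintegral_weight_lt_top {p : ℝ} (hp : 0 < p) {A : ℕ} (hA : 0 < A) (b l : ℂ) {α : ℝ}
    (hα : ‖b / l‖ < α) :
    ∫⁻ z : ℂ, ENNReal.ofReal (‖Complex.exp (b * z ^ A / l)‖ ^ p *
      Real.exp (-p * α * ‖z‖ ^ A)) < ⊤ := by
  refine lt_of_le_of_lt (lintegral_mono fun z => ENNReal.ofReal_le_ofReal ?_)
    (lintegral_exp_neg_mul_norm_pow_lt_top hA (mul_pos hp (sub_pos.2 hα)))
  rw [Complex.norm_exp, ← Real.exp_mul, ← Real.exp_add, Real.exp_le_exp]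
  have h : (b * z ^ A / l).re ≤ ‖b / l‖ * ‖z‖ ^ A := by
    refine (Complex.re_le_norm _).trans_eq ?_
    rw [mul_div_right_comm, norm_mul, norm_pow]
  nlinarith

theorem exists_fock_littlewood_paley_le {p : ℝ} (hp : 1 ≤ p) {A : ℕ} (hA : 0 < A) (b l : ℂ)
    {α : ℝ} (hα : ‖b / l‖ < α) :
    ∃ K : ℝ≥0∞, K ≠ ⊤ ∧ ∀ f : ℂ → ℂ, Differentiable ℂ f →
      ∫⁻ z : ℂ, ‖f z‖ₑ ^ p * ENNReal.ofReal (‖Complex.exp (b * z ^ A / l)‖ ^ p *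
          Real.exp (-p * α * ‖z‖ ^ A)) ≤
        K * (‖f 0‖ₑ ^ p + ∫⁻ z : ℂ, ‖deriv f z‖ₑ ^ p *
          ENNReal.ofReal (‖Complex.exp (b * z ^ A / l)‖ ^ p *
            Real.exp (-p * α * ‖z‖ ^ A) / (1 + ‖z‖) ^ (((A : ℝ) - 1) * p))) := by
  have hp0 : 0 < p := by linarith
  set W : ℂ → ℝ := fun z => ‖Complex.exp (b * z ^ A / l)‖ ^ p * Real.exp (-p * α * ‖z‖ ^ A) with hW
  set V : ℂ → ℝ := fun z => W z / (1 + ‖z‖) ^ (((A : ℝ) - 1) * p) with hV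
  have hWc : Continuous W := by
    refine Continuous.mul (Continuous.rpow_const (by fun_prop) fun _ => Or.inr hp0.le) ?_
    fun_prop
  have hWpos : ∀ z, 0 < W z := fun z => by
    have : 0 < ‖Complex.exp (b * z ^ A / l)‖ := by simp
    positivity
  have hVc : Continuous V := by
    refine hWc.div (Continuous.rpow_const (by fun_prop) fun z => Or.inl (by positivity))
      fun z => by positivity
  have hVpos : ∀ z, 0 < V z := fun z => by
    have := hWpos z
    positivity
  obtain ⟨K₀, hK₀, hloc⟩ := exists_rpow_lintegral_ball_le hp hVc hVpos 2
  set c : ℝ := α - ‖b / l‖ with hc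
  have hc0 : 0 < c := sub_pos.2 hα
  set H : ℝ≥0∞ :=
    ENNReal.ofReal (c ^ (1 - p) * (1 / c + 1 / c ^ 2) * 2 ^ (((A : ℝ) - 1) * p)) with hH
  set D : ℝ≥0∞ := 2 ^ (p - 1) with hD
  have hDt : D ≠ ⊤ := ENNReal.rpow_ne_top_of_nonneg (by linarith) (by simp)
  set M : ℝ≥0∞ := ∫⁻ z, ENNReal.ofReal (W z) with hM
  have hMt : M ≠ ⊤ := (lintegral_weight_lt_top hp0 hA b l hα).ne
  -- The terms come from `f 0`, from `f'` near the origin and from Hardy; `D` is the convexity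
  -- constant in `(x + y) ^ p ≤ D * (x ^ p + y ^ p)`.
  refine ⟨D * D * M + D * D * M * K₀ + D * H, by
    simp [hDt, hMt, hK₀, hH, ENNReal.mul_eq_top], fun f hf => ?_⟩
  have hfm : Measurable f := hf.continuous.measurable
  have hdd : Differentiable ℂ (deriv f) := fun z =>
    (hf.contDiff (n := 2)).differentiable_deriv_two z
  have hdm : Measurable (deriv f) := hdd.continuous.measurable
  set a : ℝ≥0∞ := ‖f 0‖ₑ with ha
  set S : ℝ≥0∞ := ∫⁻ z in Metric.ball (0 : ℂ) 2, ‖deriv f z‖ₑ with hS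
  set I : ℝ≥0∞ := ∫⁻ z, ‖deriv f z‖ₑ ^ p * ENNReal.ofReal (V z) with hI
  have hSI : S ^ p ≤ K₀ * I := hloc _ hdm
  have hunit : ∀ w : ℂ, ‖w‖ ≤ 1 → ‖deriv f w‖ₑ ≤ S := fun w hw =>
    (enorm_le_lintegral_ball hdd w).trans (lintegral_mono_set
      (Metric.ball_subset_ball' (by rw [dist_zero_right]; linarith)))
  let e : ℝ → ℂ := fun θ => Complex.exp (θ * Complex.I)
  have hem : Measurable e := by fun_prop
  have he : ∀ θ, ‖e θ‖ = 1 := fun θ => Complex.norm_exp_ofReal_mul_I θ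
  -- Starting at 1 makes `N` vanish for `r ≤ 1`, so only the Hardy range contributes.
  let N : ℝ → ℝ → ℝ≥0∞ := fun θ r => ∫⁻ s in Ioc 1 r, ‖deriv f (s * e θ)‖ₑ
  have hbound : ∀ (θ r : ℝ), 0 < r → ‖f (r * e θ)‖ₑ ≤ a + S + N θ r := by
    intro θ r hr
    refine (enorm_le_add_lintegral_deriv hf (e θ) (he θ) hr.le).trans ?_
    rw [add_assoc]
    gcongr
    calc ∫⁻ s in Ioc 0 r, ‖deriv f (s * e θ)‖ₑ
        ≤ ∫⁻ s in Ioc 0 1 ∪ Ioc 1 r, ‖deriv f (s * e θ)‖ₑ := lintegral_mono_set fun s hs => by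
          rcases le_or_gt s 1 with h | h
          · exact Or.inl ⟨hs.1, h⟩
          · exact Or.inr ⟨h, hs.2⟩
      _ ≤ (∫⁻ s in Ioc (0 : ℝ) 1, ‖deriv f (s * e θ)‖ₑ) + N θ r := lintegral_union_le _ _ _
      _ ≤ (∫⁻ s in Ioc (0 : ℝ) 1, S) + N θ r := by
          refine add_le_add ?_ le_rfl
          refine setLIntegral_mono' measurableSet_Ioc fun s hs => hunit _ ?_
          rw [norm_mul, he, mul_one, Complex.norm_real, Real.norm_of_nonneg hs.1.le]
          exact hs.2
      _ = S + N θ r := by simp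
  have hpow : ∀ (θ r : ℝ), 0 < r → ‖f (r * e θ)‖ₑ ^ p ≤
      D * D * (a ^ p + S ^ p) + D * N θ r ^ p := by
    intro θ r hr
    calc _ ≤ (a + S + N θ r) ^ p := ENNReal.rpow_le_rpow (hbound θ r hr) hp0.le
      _ ≤ D * ((a + S) ^ p + N θ r ^ p) := ENNReal.rpow_add_le_mul_rpow_add_rpow _ _ hp
      _ ≤ D * (D * (a ^ p + S ^ p) + N θ r ^ p) := by
          gcongr
          exact ENNReal.rpow_add_le_mul_rpow_add_rpow _ _ hp
      _ = _ := by rw [mul_add, mul_assoc]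
  have hray : ∀ θ, ∫⁻ r in Ioi (0 : ℝ), ENNReal.ofReal r *
      (N θ r ^ p * ENNReal.ofReal (W (r * e θ))) ≤ H * ∫⁻ r in Ioi (0 : ℝ), ENNReal.ofReal r *
      (‖deriv f (r * e θ)‖ₑ ^ p * ENNReal.ofReal (V (r * e θ))) := by
    intro θ
    set φ : ℝ := α - (b / l * e θ ^ A).re with hφ
    have hcφ : c ≤ φ := by
      have : (b / l * e θ ^ A).re ≤ ‖b / l‖ := by
        refine (Complex.re_le_norm _).trans_eq ?_
        rw [norm_mul, norm_pow, he]; simp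
      rw [hc, hφ]; linarith
    have hWr : ∀ r : ℝ, 0 ≤ r → W (r * e θ) = Real.exp (-p * φ * r ^ A) := fun r hr =>
      weight_polar p A b l α hr θ
    have hsplit : Ioi (0 : ℝ) = Ioc 0 1 ∪ Ioi 1 := (Ioc_union_Ioi_eq_Ioi zero_le_one).symm
    have hzero : ∫⁻ r in Ioc (0 : ℝ) 1, ENNReal.ofReal r *
        (N θ r ^ p * ENNReal.ofReal (W (r * e θ))) = 0 := by
      rw [setLIntegral_congr_fun (g := fun _ => 0) measurableSet_Ioc]
      · simp
      · intro r hr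
        simp [N, Ioc_eq_empty (not_lt.2 hr.2), hp0]
    calc _ ≤ 0 + ∫⁻ r in Ioi (1 : ℝ), ENNReal.ofReal r *
          (N θ r ^ p * ENNReal.ofReal (W (r * e θ))) := by
          rw [hsplit, ← hzero]; exact lintegral_union_le _ _ _
      _ = ∫⁻ r in Ioi (1 : ℝ), N θ r ^ p * ENNReal.ofReal (r * Real.exp (-p * φ * r ^ A)) := by
          rw [zero_add]
          refine setLIntegral_congr_fun measurableSet_Ioi fun r (hr : 1 < r) => ?_
          have hr0 : 0 ≤ r := zero_le_one.trans hr.le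
          rw [hWr r hr0, ENNReal.ofReal_mul hr0, mul_left_comm]
      _ ≤ _ := lintegral_hardy_exp_le hp hA hc0 hcφ (v := fun s => ‖deriv f (s * e θ)‖ₑ)
          (by fun_prop)
      _ = H * ∫⁻ r in Ioi (1 : ℝ), ENNReal.ofReal r *
          (‖deriv f (r * e θ)‖ₑ ^ p * ENNReal.ofReal (V (r * e θ))) := by
          congr 1
          refine setLIntegral_congr_fun measurableSet_Ioi fun r (hr : 1 < r) => ?_
          have hr0 : 0 ≤ r := zero_le_one.trans hr.le
          have hn : ‖(r : ℂ) * e θ‖ = r := by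
            rw [norm_mul, he, mul_one, Complex.norm_real, Real.norm_of_nonneg hr0]
          simp only [hV]
          rw [hWr r hr0, hn, ENNReal.ofReal_mul hr0, mul_left_comm]
      _ ≤ _ := by
          gcongr
          exact zero_le_one
  have hWm : Measurable fun z => ENNReal.ofReal (W z) := hWc.measurable.ennreal_ofReal
  have hVm : Measurable fun z => ENNReal.ofReal (V z) := hVc.measurable.ennreal_ofReal
  set B : ℝ≥0∞ := D * D * (a ^ p + S ^ p) with hB
  calc ∫⁻ z, ‖f z‖ₑ ^ p * ENNReal.ofReal (W z)
      = ∫⁻ θ in Ioo (-Real.pi) Real.pi, ∫⁻ r in Ioi (0 : ℝ), ENNReal.ofReal r *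
          (‖f (r * e θ)‖ₑ ^ p * ENNReal.ofReal (W (r * e θ))) :=
        lintegral_complex_eq_lintegral_polar (by fun_prop)
    _ ≤ ∫⁻ θ in Ioo (-Real.pi) Real.pi, ((∫⁻ r in Ioi (0 : ℝ), ENNReal.ofReal r *
          (B * ENNReal.ofReal (W (r * e θ)))) + D * (H * ∫⁻ r in Ioi (0 : ℝ), ENNReal.ofReal r *
          (‖deriv f (r * e θ)‖ₑ ^ p * ENNReal.ofReal (V (r * e θ))))) := by
        refine lintegral_mono fun θ => ?_
        refine le_trans ?_ (add_le_add_right (mul_le_mul_right (hray θ) D) _)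
        -- Only the other summand has to be measurable, so measurability of `N` is not needed.
        rw [← lintegral_const_mul' _ _ hDt, ← lintegral_add_left (by fun_prop)]
        refine setLIntegral_mono' measurableSet_Ioi fun r hr => ?_
        calc _ ≤ ENNReal.ofReal r * ((B + D * N θ r ^ p) * ENNReal.ofReal (W (r * e θ))) := by
              gcongr
              exact hpow θ r hr
          _ = _ := by ring
    _ = (∫⁻ z, B * ENNReal.ofReal (W z)) + D * (H * I) := by
        rw [hI, lintegral_complex_eq_lintegral_polar (F := fun z => B * ENNReal.ofReal (W z))
          (by fun_prop), lintegral_complex_eq_lintegral_polar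
          (F := fun z => ‖deriv f z‖ₑ ^ p * ENNReal.ofReal (V z)) (by fun_prop),
          ← lintegral_const_mul' H _ ENNReal.ofReal_ne_top, ← lintegral_const_mul' D _ hDt,
          ← lintegral_add_left]
        exact Measurable.lintegral_prod_right' (f := fun x : ℝ × ℝ => ENNReal.ofReal x.2 *
          (B * ENNReal.ofReal (W (x.2 * e x.1)))) (by fun_prop)
    _ = D * D * M * a ^ p + D * D * M * S ^ p + D * H * I := by
        rw [lintegral_const_mul _ hWm, hB]; ring
    _ ≤ D * D * M * a ^ p + D * D * M * (K₀ * I) + D * H * I := by gcongr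
    -- The added cross terms complete the product of the constant with `a ^ p + I`.
    _ ≤ (D * D * M * a ^ p + D * D * M * (K₀ * I) + D * H * I) +
          (D * D * M * K₀ * a ^ p + D * H * a ^ p + D * D * M * I) := le_self_add
    _ = _ := by ring

end FockWeights

theorem proposition2p2 (p : ℝ) (hp : 1 ≤ p) (A : ℕ) (hA : 0 < A) (b l : ℂ) (hl : l ≠ 0)
    (α : ℝ) (hα : ‖b / l‖ < α) (g : ℂ → ℂ) (hg : ∀ z, g z = b * z ^ A) :
    ∃ C : ℝ, 0 < C ∧ ∀ f : ℂ → ℂ, Differentiable ℂ f →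
      (fun z => f z * Complex.exp (g z / l)) ∈ fockSpace p α A →
      ∫⁻ z : ℂ, ENNReal.ofReal
          (‖f z‖ ^ p * ‖Complex.exp (g z / l)‖ ^ p * Real.exp (-p * α * ‖z‖ ^ A)) ≤
        ENNReal.ofReal C *
          (ENNReal.ofReal (‖f 0‖ ^ p) +
            ∫⁻ z : ℂ, ENNReal.ofReal
              (‖deriv f z‖ ^ p * ‖Complex.exp (g z / l)‖ ^ p *
                (Real.exp (-p * α * ‖z‖ ^ A) / (1 + ‖z‖) ^ (((A : ℝ) - 1) * p)))) := by
  have hp0 : 0 ≤ p := by linarith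
  obtain ⟨K, hK, h⟩ := exists_fock_littlewood_paley_le hp hA b l hα
  -- Adding 1 keeps the constant positive even if `K = 0`.
  refine ⟨K.toReal + 1, by positivity, fun f hf _ => ?_⟩
  have hle : K ≤ ENNReal.ofReal (K.toReal + 1) := by
    rw [← ENNReal.ofReal_toReal hK]
    exact ENNReal.ofReal_le_ofReal (by simp)
  have hnorm : ∀ w : ℂ, ENNReal.ofReal (‖w‖ ^ p) = ‖w‖ₑ ^ p := fun w => by
    rw [← ENNReal.ofReal_rpow_of_nonneg (norm_nonneg _) hp0, ofReal_norm]
  have hmul : ∀ (w : ℂ) (x y : ℝ), ENNReal.ofReal (‖w‖ ^ p * x * y) =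
      ‖w‖ₑ ^ p * ENNReal.ofReal (x * y) := fun w x y => by
    rw [mul_assoc, ENNReal.ofReal_mul (by positivity), hnorm]
  simp only [hmul, hnorm, hg, mul_div_assoc] at h ⊢
  exact (h f hf).trans (by gcongr)
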